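/- Let $n\ge 1$, let $H\in\mathbb R^{n\times n}$ be symmetric with $\|H\|\le M$ (spectral norm), let $\epsilon>0$ and $\delta\in[0,1)$, and let $b$ be uniformly distributed on the unit sphere of $\mathbb R^n$. Put $\bar H=H+\tfrac{\epsilon}{2}I$ and $$\bar J=\min\Big\{n,\ 1+\Big\lceil \tfrac12\ln(2.75\,n/\delta^2)\sqrt{M/\epsilon}\Big\rceil\Big\}\qquad(\bar J=n\text{ if }\delta=0).$$ Run the standard conjugate gradient method on $\bar H d=b$: set $y_0=0$, $r_0=-b$, $p_0=b$; as long as $p_j^\top\bar H p_j>0$ and $r_j\neq0$, set $\alpha_j=\frac{r_j^\top r_j}{p_j^\top\bar H p_j}$, $y_{j+1}=y_j+\alpha_jp_j$, $r_{j+1}=r_j+\alpha_j\bar Hp_j$, $\beta_{j+1}=\frac{r_{j+1}^\top r_{j+1}}{r_j^\top r_j}$, $p_{j+1}=-r_{j+1}+\beta_{j+1}p_j$; terminate at the first index $j$ for which $p_j^\top\bar H p_j\le0$ or $r_j=0$. The iteration with index $j$ is the one in which $p_j$ is examined, so that the first $\bar J$ iterations are those with $j=0,\dots,\bar J-1$.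 (a) If $\lambda_{\min}(H)<-\epsilon$, then with probability at least $1-\delta$ the method terminates within the first $\bar J$ iterations, at some index $j<\bar J$, with a direction $p_j\ne0$ such that $p_j^\top Hp_j\le-\tfrac{\epsilon}{2}\|p_j\|^2$. (b) Conversely, if none of the directions examined in the first $\bar J$ iterations (in particular, if $\bar J$ iterations are run without terminating) is a nonzero direction of nonpositive curvature for $\bar H$, then $\lambda_{\min}(H)\ge-\epsilon$ with probability at least $1-\delta$; that is, with probability at least $1-\delta$ over $b$ the implication "no such direction is found in the first $\bar J$ iterations $\Rightarrow\lambda_{\min}(H)\ge-\epsilon$" holds. -/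

import Mathlib

open MeasureTheory

/-- The quadratic form `vᵀ A v` of a real matrix. -/
noncomputable def quadForm {n : ℕ} (A : Matrix (Fin n) (Fin n) ℝ)
    (v : EuclideanSpace ℝ (Fin n)) : ℝ :=
  inner ℝ v (Matrix.toEuclideanCLM (n := Fin n) (𝕜 := ℝ) A v)

/-- The variables of the conjugate gradient method: iterate `y`, residual `r`,
search direction `p`. -/
structure CGState (n : ℕ) where
  y : EuclideanSpace ℝ (Fin n)
  r : EuclideanSpace ℝ (Fin n)
  p : EuclideanSpace ℝ (Fin n)

namespace CGState

/-- Initialization: `r₀ = g`, `p₀ = -r₀`, `y₀ = 0`. -/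
noncomputable def init {n : ℕ} (g : EuclideanSpace ℝ (Fin n)) : CGState n where
  y := 0
  r := g
  p := -g

/-- The test of the `while` loop: `pᵀ A p > 0` and `r ≠ 0`. -/
def Guard {n : ℕ} (A : Matrix (Fin n) (Fin n) ℝ) (s : CGState n) : Prop :=
  0 < quadForm A s.p ∧ s.r ≠ 0

/-- The step length `α = rᵀ r / pᵀ A p`. -/
noncomputable def alpha {n : ℕ} (A : Matrix (Fin n) (Fin n) ℝ) (s : CGState n) : ℝ :=
  inner ℝ s.r s.r / quadForm A s.p

/-- The next residual `r + α A p`. -/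
noncomputable def nextR {n : ℕ} (A : Matrix (Fin n) (Fin n) ℝ) (s : CGState n) :
    EuclideanSpace ℝ (Fin n) :=
  s.r + s.alpha A • Matrix.toEuclideanCLM (n := Fin n) (𝕜 := ℝ) A s.p

/-- The coefficient `β = r₊ᵀ r₊ / rᵀ r`, where `r₊` is the next residual. -/
noncomputable def beta {n : ℕ} (A : Matrix (Fin n) (Fin n) ℝ) (s : CGState n) : ℝ :=
  inner ℝ (s.nextR A) (s.nextR A) / inner ℝ s.r s.r

/-- The body of the `while` loop. -/
noncomputable def next {n : ℕ} (A : Matrix (Fin n) (Fin n) ℝ) (s : CGState n) : CGState n where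
  y := s.y + s.alpha A • s.p
  r := s.nextR A
  p := -s.nextR A + s.beta A • s.p

end CGState

/-- The state of CG, applied to `A` and `g`, at index `j`. It is a state of the algorithm
only if index `j` is reached (`CGReaches`), that is, if the loop test held at all earlier
indices; then all the divisions performed so far had nonzero denominators. -/
noncomputable def cgState {n : ℕ} (A : Matrix (Fin n) (Fin n) ℝ)
    (g : EuclideanSpace ℝ (Fin n)) : ℕ → CGState n
  | 0 => CGState.init g
  | j + 1 => (cgState A g j).next A

/-- The algorithm has not terminated before index `j`. -/
def CGReaches {n : ℕ} (A : Matrix (Fin n) (Fin n) ℝ) (g : EuclideanSpace ℝ (Fin n))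
    (j : ℕ) : Prop :=
  ∀ i < j, (cgState A g i).Guard A

/-- The algorithm terminates at index `j`: the loop test fails there for the first time. -/
def CGTerminatesAt {n : ℕ} (A : Matrix (Fin n) (Fin n) ℝ) (g : EuclideanSpace ℝ (Fin n))
    (j : ℕ) : Prop :=
  CGReaches A g j ∧ ¬ (cgState A g j).Guard A

/-- Within its first `k` iterations (those with index `j = 0, …, k - 1`) the algorithm
encounters a search direction `p_j ≠ 0` of nonpositive curvature for `A`. -/
def CGFindsNonposCurvature {n : ℕ} (A : Matrix (Fin n) (Fin n) ℝ)
    (g : EuclideanSpace ℝ (Fin n)) (k : ℕ) : Prop :=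
  ∃ j < k, CGReaches A g j ∧ (cgState A g j).p ≠ 0 ∧ quadForm A (cgState A g j).p ≤ 0

/-- The uniform probability distribution on the unit sphere of `ℝⁿ` (for `n ≥ 1`):
the normalized surface measure. -/
noncomputable def uniformSphere (n : ℕ) :
    Measure (Metric.sphere (0 : EuclideanSpace ℝ (Fin n)) 1) :=
  ((volume : Measure (EuclideanSpace ℝ (Fin n))).toSphere Set.univ)⁻¹ •
    (volume : Measure (EuclideanSpace ℝ (Fin n))).toSphere

/-- The smallest eigenvalue of a real symmetric `n × n` matrix (for `n ≥ 1`). -/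
noncomputable def lambdaMin {n : ℕ} {H : Matrix (Fin n) (Fin n) ℝ} (hH : H.IsHermitian) : ℝ :=
  ⨅ i, hH.eigenvalues i

/-- The iteration limit `min {n, 1 + ⌈½ ln (2.75 n / δ²) √(M / ε)⌉}`; for `δ = 0` the
logarithm is `+∞`, so the limit is `n`. -/
noncomputable def iterLimit (n : ℕ) (M ε δ : ℝ) : ℕ :=
  if δ = 0 then n
  else min n (1 + ⌈1 / 2 * Real.log (2.75 * n / δ ^ 2) * √(M / ε)⌉₊)

/-!
Why the theorem holds. Put `A = H + (ε / 2) I`, with eigenvalues `μ_j` and orthonormal eigenvectors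
`v_j`, and let `k` be the iteration limit. Assume that `λ_min(H) < -ε`, so that some `μ_i < -ε / 2`.

*Deterministic part.* If conjugate gradients meet no direction of nonpositive curvature in the
first `k` iterations, the directions met are `A`-conjugate and span all `q(A) b` with
`deg q < k`, so `∑ j, μ_j q(μ_j)² ⟨v_j, b⟩² ≥ 0` for all these `q` (`cgRegular_of_not_finds`,
`aeval_apply_mem_span`, `quadForm_nonneg_of_mem_span`). If `μ_j q(μ_j)² ≤ c` for all `j` and
`d ≤ -μ_i q(μ_i)²`, then `b` lies in the double cone `d ⟨v_i, b⟩² ≤ c ∑_{j ≠ i} ⟨v_j, b⟩²`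
(`mul_inner_sq_le_of_not_finds`).

*Probability of the cone.* The uniform distribution on the sphere is the radial projection of the
standard Gaussian distribution (`uniformSphere_preimage_eq_stdGaussian`). In Gaussian coordinates,
conditioning on all coordinates but the `i`-th and bounding the density of that one by its value at
`0`, then bounding `E √(∑_{j ≠ i} x_j²)` by `√(n - 1)`, shows that the cone has probability at most
`√((2 / π) (n - 1) c / d)` (`uniformSphere_double_cone_le`).

*Choice of the polynomial* (`exists_polynomial_iterLimit`). If `k = n`, take the `q` that vanishes
at all eigenvalues other than `μ_i`; then `c = 0`. Otherwise `k = N + 1` with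
`N ≥ ½ ln (2.75 n / δ²) √(M / ε)`, and with `L = M + ε / 2` the polynomial is given by
`x q(x²) = T_{2N+1}(x / √L)` up to a constant factor, where `T` denotes the Chebyshev polynomials.
On `[0, L]` these are cosines, and at `μ_i < 0` they are hyperbolic sines, which makes `d / c` at
least `(2.75 n / δ² - 2) / 4`, and the cone has probability at most `δ`.
-/

/-! ### The uniform distribution on the sphere and Gaussian vectors -/

open ProbabilityTheory in
theorem pi_gaussianReal_eq_withDensity (ι : Type*) [Fintype ι] :
    Measure.pi (fun _ : ι => gaussianReal 0 1) = (volume : Measure (ι → ℝ)).withDensity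
      (fun x => ENNReal.ofReal (∏ i, gaussianPDFReal 0 1 (x i))) := by
  refine Measure.pi_eq fun s hs => ?_
  have hint : Integrable (fun x : ι → ℝ => ∏ i, gaussianPDFReal 0 1 (x i)) :=
    Integrable.fintype_prod fun _ => integrable_gaussianPDFReal 0 1
  rw [withDensity_apply _ (MeasurableSet.univ_pi hs),
    ← ofReal_integral_eq_lintegral_ofReal hint.restrict
      (.of_forall fun x => Finset.prod_nonneg fun i _ => gaussianPDFReal_nonneg 0 1 (x i)),
    volume_pi, Measure.restrict_pi_pi,
    integral_fintype_prod_eq_prod (fun _ : ι => gaussianPDFReal 0 1),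
    ENNReal.ofReal_prod_of_nonneg fun i _ =>
      integral_nonneg fun x => gaussianPDFReal_nonneg 0 1 x]
  exact Finset.prod_congr rfl fun i _ =>
    (gaussianReal_apply_eq_integral 0 one_ne_zero (s i)).symm

open ProbabilityTheory in
theorem stdGaussian_eq_withDensity_norm (ι : Type*) [Fintype ι] :
    stdGaussian (EuclideanSpace ℝ ι) = (volume : Measure (EuclideanSpace ℝ ι)).withDensity
      (fun x => ENNReal.ofReal
        ((√(2 * Real.pi))⁻¹ ^ Fintype.card ι * Real.exp (-‖x‖ ^ 2 / 2))) := by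
  ext s hs
  rw [← map_pi_eq_stdGaussian, Measure.map_apply (by fun_prop) hs, pi_gaussianReal_eq_withDensity,
    withDensity_apply _ hs, withDensity_apply _ (by measurability),
    ← (PiLp.volume_preserving_toLp ι).setLIntegral_comp_preimage hs (by fun_prop)]
  refine lintegral_congr fun x => ?_
  simp [gaussianPDFReal_def, Finset.prod_mul_distrib, ← Real.exp_sum, EuclideanSpace.real_norm_sq_eq,
    Finset.sum_div, neg_div, Finset.card_univ]

/-- Polar coordinates: a measure with radial density gives to a cone a multiple of the surface
measure of its trace on the sphere, with a factor that does not depend on the cone. -/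
theorem withDensity_norm_apply_cone {E : Type*} [NormedAddCommGroup E] [NormedSpace ℝ E]
    [MeasurableSpace E] [BorelSpace E] [FiniteDimensional ℝ E] [Nontrivial E] (μ : Measure E)
    [μ.IsAddHaarMeasure] {φ : ℝ → ENNReal} (hφ : Measurable φ) {D : Set E} (hD : MeasurableSet D)
    (hcone : ∀ x ∈ D, ∀ r : ℝ, 0 < r → r • x ∈ D) :
    μ.withDensity (fun x => φ ‖x‖) D = μ.toSphere (Subtype.val ⁻¹' D) *
      ∫⁻ r : Set.Ioi (0 : ℝ), φ r ∂Measure.volumeIoiPow (Module.finrank ℝ E - 1) := by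
  have hS : MeasurableSet (Subtype.val ⁻¹' D : Set (Metric.sphere (0 : E) 1)) :=
    measurable_subtype_coe hD
  have h1 : ∀ x : ({0}ᶜ : Set E), D.indicator (fun x => φ ‖x‖) x.1 =
      (Subtype.val ⁻¹' D : Set (Metric.sphere (0 : E) 1)).indicator 1
        (homeomorphUnitSphereProd E x).1 * φ (homeomorphUnitSphereProd E x).2 := by
    intro x
    have hx : 0 < ‖x.1‖ := norm_pos_iff.2 x.2
    have hiff : x.1 ∈ D ↔ (homeomorphUnitSphereProd E x).1.1 ∈ D := by
      rw [homeomorphUnitSphereProd_apply_fst_coe]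
      refine ⟨fun h => hcone _ h _ (inv_pos.2 hx), fun h => ?_⟩
      simpa [smul_smul, hx.ne'] using hcone _ h _ hx
    by_cases h : x.1 ∈ D
    · rw [Set.indicator_of_mem h, Set.indicator_of_mem (by exact hiff.1 h)]; simp
    · rw [Set.indicator_of_notMem h, Set.indicator_of_notMem (by exact fun h' => h (hiff.2 h'))]
      simp
  have h2 : ∫⁻ x, D.indicator (fun x => φ ‖x‖) x ∂μ =
      ∫⁻ x : ({0}ᶜ : Set E), D.indicator (fun x => φ ‖x‖) x.1 ∂μ.comap (↑) := by
    rw [lintegral_subtype_comap (measurableSet_singleton _).compl, restrict_compl_singleton]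
  rw [withDensity_apply _ hD, ← lintegral_indicator hD, h2, lintegral_congr h1,
    μ.measurePreserving_homeomorphUnitSphereProd.lintegral_comp
      (f := fun p => (Subtype.val ⁻¹' D : Set (Metric.sphere (0 : E) 1)).indicator 1 p.1 * φ p.2)
      (((measurable_one.indicator hS).comp measurable_fst).mul
        (hφ.comp (measurable_subtype_coe.comp measurable_snd))),
    lintegral_prod_mul (g := fun r : Set.Ioi (0 : ℝ) => φ r)
      (measurable_one.indicator hS).aemeasurable
      (hφ.comp measurable_subtype_coe).aemeasurable, lintegral_indicator_one hS]

open ProbabilityTheory in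
/-- The uniform distribution on the sphere is the law of `x / ‖x‖` for a standard Gaussian vector
`x`, expressed through cones. -/
theorem uniformSphere_preimage_eq_stdGaussian {n : ℕ} (hn : 1 ≤ n)
    {C : Set (EuclideanSpace ℝ (Fin n))} (hC : MeasurableSet C)
    (hcone : ∀ x ∈ C, ∀ r : ℝ, 0 < r → r • x ∈ C) :
    uniformSphere n (Subtype.val ⁻¹' C) = stdGaussian (EuclideanSpace ℝ (Fin n)) C := by
  have : Nonempty (Fin n) := ⟨⟨0, hn⟩⟩
  obtain ⟨φ, hφ, hG⟩ : ∃ φ : ℝ → ENNReal, Measurable φ ∧ stdGaussian (EuclideanSpace ℝ (Fin n)) =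
      (volume : Measure (EuclideanSpace ℝ (Fin n))).withDensity fun x => φ ‖x‖ :=
    ⟨fun r => ENNReal.ofReal
        ((√(2 * Real.pi))⁻¹ ^ Fintype.card (Fin n) * Real.exp (-r ^ 2 / 2)), by fun_prop,
      stdGaussian_eq_withDensity_norm (Fin n)⟩
  have huniv := withDensity_norm_apply_cone
    (volume : Measure (EuclideanSpace ℝ (Fin n))) hφ .univ (by simp)
  rw [← hG, measure_univ, Set.preimage_univ, mul_comm] at huniv
  rw [hG, withDensity_norm_apply_cone _ hφ hC hcone,
    ENNReal.eq_inv_of_mul_eq_one_left huniv.symm, uniformSphere, Measure.smul_apply, smul_eq_mul,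
    mul_comm]

theorem isProbabilityMeasure_uniformSphere {n : ℕ} (hn : 1 ≤ n) :
    IsProbabilityMeasure (uniformSphere n) :=
  ⟨by simpa using uniformSphere_preimage_eq_stdGaussian hn (C := Set.univ) .univ (by simp)⟩

open ProbabilityTheory in
/-- The density of the standard normal distribution is at most `1 / √(2π)`. -/
theorem gaussianReal_sq_le (s : ℝ) :
    gaussianReal 0 1 {a | a ^ 2 ≤ s} ≤ ENNReal.ofReal (√(2 / Real.pi) * √s) := by
  rcases lt_or_ge s 0 with hs | hs
  · have : {a : ℝ | a ^ 2 ≤ s} = ∅ := by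
      ext a; simpa using hs.trans_le (sq_nonneg a)
    simp [this]
  have hset : {a : ℝ | a ^ 2 ≤ s} = Set.Icc (-√s) √s := by
    ext a; simp [Real.sq_le hs]
  have hpdf : ∀ x, gaussianPDF 0 1 x ≤ ENNReal.ofReal (√(2 * Real.pi))⁻¹ := fun x => by
    refine ENNReal.ofReal_le_ofReal ?_
    simp only [gaussianPDFReal_def, NNReal.coe_one, mul_one]
    refine mul_le_of_le_one_right (by positivity) (Real.exp_le_one_iff.2 ?_)
    have := sq_nonneg (x - 0)
    linarith
  rw [gaussianReal_apply 0 one_ne_zero, hset]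
  refine (setLIntegral_mono' measurableSet_Icc fun x _ => hpdf x).trans ?_
  rw [setLIntegral_const, Real.volume_Icc, ← ENNReal.ofReal_mul (by positivity)]
  refine ENNReal.ofReal_le_ofReal (le_of_eq ?_)
  have h2 : √(2 * Real.pi) * √(2 / Real.pi) = 2 := by
    rw [← Real.sqrt_mul (by positivity), show 2 * Real.pi * (2 / Real.pi) = 2 ^ 2 by
      field_simp]
    exact Real.sqrt_sq (by norm_num)
  have h3 : √(2 * Real.pi) ≠ 0 := by positivity
  field_simp
  linear_combination (-√s) * h2

open ProbabilityTheory in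
theorem lintegral_sqrt_sum_sq_gaussian_le (m : ℕ) :
    ∫⁻ x : Fin m → ℝ, ENNReal.ofReal √(∑ j, x j ^ 2) ∂Measure.pi (fun _ => gaussianReal 0 1) ≤
      ENNReal.ofReal √m := by
  rcases Nat.eq_zero_or_pos m with rfl | hm
  · simp
  have hm' : (0 : ℝ) < √m := Real.sqrt_pos.2 (by exact_mod_cast hm)
  have hsq1 : Integrable (fun a : ℝ => a ^ 2) (gaussianReal 0 1) :=
    (memLp_id_gaussianReal 2).integrable_sq
  have hval : ∫ a : ℝ, a ^ 2 ∂gaussianReal 0 1 = 1 := by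
    have := variance_fun_id_gaussianReal (μ := 0) (v := 1)
    rw [variance_eq_integral (by fun_prop)] at this
    simpa using this
  have hint (j : Fin m) : Integrable (fun x : Fin m → ℝ => x j ^ 2)
      (Measure.pi fun _ => gaussianReal 0 1) :=
    integrable_comp_eval (μ := fun _ : Fin m => gaussianReal 0 1) (i := j)
      (f := fun a : ℝ => a ^ 2) hsq1
  have hsum : Integrable (fun x : Fin m → ℝ => ∑ j, x j ^ 2)
      (Measure.pi fun _ => gaussianReal 0 1) :=
    integrable_finsetSum _ fun j _ => hint j
  have hsumval : ∫ x : Fin m → ℝ, ∑ j, x j ^ 2 ∂(Measure.pi fun _ => gaussianReal 0 1) = m := by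
    rw [integral_finsetSum _ fun j _ => hint j]
    have hcoord (j : Fin m) :
        ∫ x : Fin m → ℝ, x j ^ 2 ∂(Measure.pi fun _ => gaussianReal 0 1) = 1 :=
      (integral_comp_eval (μ := fun _ : Fin m => gaussianReal 0 1) (i := j)
        (f := fun a : ℝ => a ^ 2) hsq1.aestronglyMeasurable).trans hval
    simp [hcoord]
  calc _ ≤ ∫⁻ x : Fin m → ℝ, ENNReal.ofReal ((∑ j, x j ^ 2) * (2 * √m)⁻¹ + √m / 2)
        ∂Measure.pi (fun _ => gaussianReal 0 1) := by
        refine lintegral_mono fun x => ENNReal.ofReal_le_ofReal ?_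
        -- the inequality of arithmetic and geometric means for `√s` and `√m`
        have h1 : 0 ≤ ∑ j, x j ^ 2 := Finset.sum_nonneg fun j _ => sq_nonneg _
        have h2 := Real.sq_sqrt h1
        have h3 := sq_nonneg (√(∑ j, x j ^ 2) - √m)
        rw [← h2]
        rw [← mul_le_mul_iff_left₀ (show 0 < 2 * √m by positivity)]
        field_simp
        rw [Real.sqrt_sq (Real.sqrt_nonneg _)]
        nlinarith
    _ = ENNReal.ofReal √m := by
        have hint' : Integrable (fun x : Fin m → ℝ => (∑ j, x j ^ 2) * (2 * √m)⁻¹ + √m / 2)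
            (Measure.pi fun _ => gaussianReal 0 1) :=
          (hsum.mul_const _).add (integrable_const _)
        rw [← ofReal_integral_eq_lintegral_ofReal hint' (.of_forall fun x => ?_),
          integral_add (hsum.mul_const _) (integrable_const _), integral_mul_const, hsumval]
        · congr 1
          have := Real.sq_sqrt (Nat.cast_nonneg (α := ℝ) m)
          simp
          field_simp
          linarith
        · have h1 : 0 ≤ ∑ j, x j ^ 2 := Finset.sum_nonneg fun j _ => sq_nonneg _
          positivity

open ProbabilityTheory in
/-- The probability that a uniform random point of the sphere is nearly orthogonal to `v i`. -/
theorem uniformSphere_double_cone_le {m : ℕ}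
    (v : OrthonormalBasis (Fin (m + 1)) ℝ (EuclideanSpace ℝ (Fin (m + 1)))) (i : Fin (m + 1))
    {τ : ℝ} (hτ : 0 ≤ τ) :
    (uniformSphere (m + 1)).real
      {b | inner ℝ (v i) b.1 ^ 2 ≤ τ * ∑ j, inner ℝ (v (i.succAbove j)) b.1 ^ 2} ≤
      √(2 / Real.pi * m * τ) := by
  set C : Set (EuclideanSpace ℝ (Fin (m + 1))) :=
    {x | inner ℝ (v i) x ^ 2 ≤ τ * ∑ j, inner ℝ (v (i.succAbove j)) x ^ 2} with hCdef
  have hC : MeasurableSet C := measurableSet_le (by fun_prop) (by fun_prop)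
  have hcone : ∀ x ∈ C, ∀ r : ℝ, 0 < r → r • x ∈ C := by
    intro x hx r hr
    simp only [hCdef, Set.mem_ofPred_eq, inner_smul_right, mul_pow, ← Finset.mul_sum] at hx ⊢
    nlinarith [mul_le_mul_of_nonneg_left hx (sq_nonneg r)]
  have hpre : MeasurableEquiv.piFinSuccAbove (fun _ => ℝ) i ⁻¹'
      {p : ℝ × (Fin m → ℝ) | p.1 ^ 2 ≤ τ * ∑ j, p.2 j ^ 2} =
      (fun x : Fin (m + 1) → ℝ => ∑ k, x k • v k) ⁻¹' C := by
    ext x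
    simp [hCdef, v.orthonormal.inner_right_fintype, Fin.removeNth]
  have hT : MeasurableSet {p : ℝ × (Fin m → ℝ) | p.1 ^ 2 ≤ τ * ∑ j, p.2 j ^ 2} :=
    measurableSet_le (by fun_prop) (by fun_prop)
  have hmain : uniformSphere (m + 1) (Subtype.val ⁻¹' C) ≤
      ENNReal.ofReal √(2 / Real.pi * m * τ) := by
    rw [uniformSphere_preimage_eq_stdGaussian (by lia) hC hcone,
      stdGaussian_eq_map_pi_orthonormalBasis v, Measure.map_apply (by fun_prop) hC, ← hpre,
      (measurePreserving_piFinSuccAbove (fun _ => gaussianReal 0 1) i).measure_preimage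
        hT.nullMeasurableSet, Measure.prod_apply_symm hT]
    calc _ ≤ ∫⁻ y : Fin m → ℝ, ENNReal.ofReal (√(2 / Real.pi) * √τ) *
          ENNReal.ofReal √(∑ j, y j ^ 2) ∂Measure.pi (fun _ => gaussianReal 0 1) := by
          refine lintegral_mono fun y => (gaussianReal_sq_le (τ * ∑ j, y j ^ 2)).trans (le_of_eq ?_)
          rw [← ENNReal.ofReal_mul (by positivity), Real.sqrt_mul hτ, mul_assoc]
      _ ≤ ENNReal.ofReal (√(2 / Real.pi) * √τ) * ENNReal.ofReal √m := by
          rw [lintegral_const_mul _ (by fun_prop)]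
          gcongr
          exact lintegral_sqrt_sum_sq_gaussian_le m
      _ = _ := by
          rw [← ENNReal.ofReal_mul (by positivity), ← Real.sqrt_mul (by positivity),
            ← Real.sqrt_mul (by positivity)]
          congr 2
          ring
  exact ENNReal.toReal_le_of_le_ofReal (Real.sqrt_nonneg _) hmain

/-! ### Conjugate gradients and Krylov spaces -/

/-- A state at which conjugate gradients either go on, or have solved the system and stay put:
since `x / 0 = 0`, the recursion maps a state with `r = 0` and `p = 0` to one of the same kind.
Thus early termination by `r = 0` needs no separate treatment: without nonpositive curvature, all
states of the recursion are regular. -/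
def CGRegular {n : ℕ} (A : Matrix (Fin n) (Fin n) ℝ) (s : CGState n) : Prop :=
  s.Guard A ∨ (s.r = 0 ∧ s.p = 0)

section CG
variable {n : ℕ} {A : Matrix (Fin n) (Fin n) ℝ} {g : EuclideanSpace ℝ (Fin n)}

local notation "T" => Matrix.toEuclideanCLM (n := Fin n) (𝕜 := ℝ) A

theorem inner_toEuclideanCLM_comm (hA : A.IsHermitian) (x y : EuclideanSpace ℝ (Fin n)) :
    inner ℝ (T x) y = inner ℝ x (T y) := by
  have h : IsSelfAdjoint T := by
    rw [IsSelfAdjoint, ← map_star]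
    exact congrArg _ hA
  exact h.isSymmetric x y

/-- States with `r = 0` are followed by such states, with `p = 0`: there `α = 0`, and `β = 0 / 0`
takes the value `0`. -/
theorem CGState.next_of_r_eq_zero {s : CGState n} (h : s.r = 0) :
    (s.next A).r = 0 ∧ (s.next A).p = 0 := by
  simp [CGState.next, CGState.nextR, CGState.alpha, CGState.beta, h]

theorem CGState.smul_apply_p (s : CGState n) :
    s.alpha A • T s.p = (s.next A).r - s.r := by
  simp [CGState.next, CGState.nextR]

theorem CGState.next_p (s : CGState n) : (s.next A).p = -(s.next A).r + s.beta A • s.p := rfl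

theorem CGState.alpha_mul_quadForm {s : CGState n} (h : s.Guard A) :
    s.alpha A * quadForm A s.p = inner ℝ s.r s.r :=
  div_mul_cancel₀ _ h.1.ne'

theorem CGState.alpha_pos {s : CGState n} (h : s.Guard A) : 0 < s.alpha A :=
  div_pos (real_inner_self_pos.2 h.2) h.1

theorem cgState_succ (j : ℕ) : cgState A g (j + 1) = (cgState A g j).next A := rfl

variable (A g) in
/-- The orthogonality relations of conjugate gradients at index `j`: the residual `r_j` is
orthogonal to the previous directions, `p_j` is `A`-conjugate to them, and
`⟨r_j, p_j⟩ = -‖r_j‖²`. -/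
structure CGInvariant (j : ℕ) : Prop where
  inner_r_p : ∀ i < j, inner ℝ (cgState A g j).r (cgState A g i).p = 0
  inner_p_apply_p : ∀ i < j, inner ℝ (cgState A g j).p (T (cgState A g i).p) = 0
  inner_r_p_self : inner ℝ (cgState A g j).r (cgState A g j).p =
    -inner ℝ (cgState A g j).r (cgState A g j).r

theorem CGInvariant.of_r_p_eq_zero {j : ℕ} (hr : (cgState A g j).r = 0)
    (hp : (cgState A g j).p = 0) : CGInvariant A g j := by
  constructor <;> simp [hr, hp]

theorem CGInvariant.succ (hA : A.IsHermitian) {j : ℕ} (h : CGInvariant A g j)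
    (hreg : ∀ i ≤ j, CGRegular A (cgState A g i)) : CGInvariant A g (j + 1) := by
  rcases hreg j le_rfl with hG | hG
  swap
  · obtain ⟨h1, h2⟩ := CGState.next_of_r_eq_zero (A := A) hG.1
    exact .of_r_p_eq_zero h1 h2
  have hr : ∀ x, inner ℝ (cgState A g (j + 1)).r x = inner ℝ (cgState A g j).r x +
      (cgState A g j).alpha A * inner ℝ (cgState A g j).p (T x) := fun x => by
    rw [cgState_succ, show ((cgState A g j).next A).r = (cgState A g j).r +
      (cgState A g j).alpha A • T (cgState A g j).p from rfl, inner_add_left,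
      real_inner_smul_left, inner_toEuclideanCLM_comm hA]
  have hrp : ∀ i < j + 1, inner ℝ (cgState A g (j + 1)).r (cgState A g i).p = 0 := by
    intro i hi
    rw [hr]
    rcases Nat.lt_succ_iff_lt_or_eq.1 hi with hi | rfl
    · rw [h.inner_r_p i hi, h.inner_p_apply_p i hi]; simp
    · rw [h.inner_r_p_self]
      have := CGState.alpha_mul_quadForm hG
      rw [quadForm] at this
      linarith
  have hrr : ∀ i < j + 1, inner ℝ (cgState A g (j + 1)).r (cgState A g i).r = 0 := by
    intro i hi
    cases i with
    | zero => simpa [cgState, CGState.init] using hrp 0 hi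
    | succ i =>
      have h1 := hrp (i + 1) hi
      rw [cgState_succ (j := i), CGState.next_p, inner_add_right, inner_neg_right,
        inner_smul_right, hrp i (by lia)] at h1
      rw [cgState_succ (j := i)]
      linarith
  refine ⟨hrp, fun i hi => ?_, ?_⟩
  · have hp : inner ℝ (cgState A g (j + 1)).p (T (cgState A g i).p) =
        -inner ℝ (cgState A g (j + 1)).r (T (cgState A g i).p) +
        (cgState A g j).beta A * inner ℝ (cgState A g j).p (T (cgState A g i).p) := by
      rw [cgState_succ j, CGState.next_p, inner_add_left, inner_neg_left, real_inner_smul_left]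
    rcases hreg i (by lia) with hGi | hGi
    swap
    · simp [hGi.2]
    have hα := CGState.alpha_pos hGi
    have hT : (cgState A g i).alpha A * inner ℝ (cgState A g (j + 1)).r (T (cgState A g i).p) =
        inner ℝ (cgState A g (j + 1)).r (cgState A g (i + 1)).r := by
      rw [← inner_smul_right, CGState.smul_apply_p, inner_sub_right, hrr i hi, sub_zero,
        ← cgState_succ]
    rcases Nat.lt_succ_iff_lt_or_eq.1 hi with hi' | rfl
    · rw [hrr (i + 1) (by lia)] at hT
      rw [hp, h.inner_p_apply_p i hi', (mul_eq_zero.1 hT).resolve_left hα.ne']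
      simp
    · have h1 := CGState.alpha_mul_quadForm hGi
      have h2 : (cgState A g i).beta A * inner ℝ (cgState A g i).r (cgState A g i).r =
          inner ℝ (cgState A g (i + 1)).r (cgState A g (i + 1)).r :=
        div_mul_cancel₀ _ (inner_self_ne_zero.2 hGi.2)
      rw [← mul_right_inj' hα.ne', hp, mul_zero]
      change _ * (_ + _ * quadForm A _) = 0
      linear_combination -hT + (cgState A g i).beta A * h1 + h2
  · rw [cgState_succ j, CGState.next_p, ← cgState_succ, inner_add_right, inner_neg_right,
      inner_smul_right, hrp j (by lia), mul_zero, add_zero]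

theorem cgInvariant_of_regular (hA : A.IsHermitian) {j : ℕ}
    (hreg : ∀ i < j, CGRegular A (cgState A g i)) : CGInvariant A g j := by
  induction j with
  | zero => exact ⟨by simp, by simp, by simp [cgState, CGState.init]⟩
  | succ j ih => exact (ih fun i hi => hreg i (by lia)).succ hA fun i hi => hreg i (by lia)

theorem p_eq_zero_of_r_eq_zero {j : ℕ} (h : (cgState A g j).r = 0) : (cgState A g j).p = 0 := by
  cases j with
  | zero => simpa [cgState, CGState.init] using h
  | succ j =>
    have h' : (cgState A g j).nextR A = 0 := h
    rw [cgState_succ, CGState.next_p, ← cgState_succ, h, CGState.beta, h']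
    simp

theorem CGReaches.regular (hA : A.IsHermitian) {k i : ℕ}
    (h : ¬ CGFindsNonposCurvature A g k) (hi : i < k) (hreach : CGReaches A g i) :
    CGRegular A (cgState A g i) := by
  by_cases hr : (cgState A g i).r = 0
  · exact .inr ⟨hr, p_eq_zero_of_r_eq_zero hr⟩
  refine .inl ⟨?_, hr⟩
  by_contra hq
  refine h ⟨i, hi, hreach, fun hp => hr ?_, not_lt.1 hq⟩
  have := (cgInvariant_of_regular hA fun l hl => .inl (hreach l hl)).inner_r_p_self
  rw [hp, inner_zero_right] at this
  exact inner_self_eq_zero.1 (neg_eq_zero.1 this.symm)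

/-- Without nonpositive curvature in the first `k` iterations, conjugate gradients either run
through, or terminate by solving the system and stay put from then on. -/
theorem cgRegular_of_not_finds (hA : A.IsHermitian) {k : ℕ}
    (h : ¬ CGFindsNonposCurvature A g k) : ∀ i < k, CGRegular A (cgState A g i) := by
  have hmain : ∀ i < k, CGReaches A g i ∨ (cgState A g i).r = 0 := by
    intro i
    induction i with
    | zero => exact fun _ => .inl fun l hl => absurd hl (by lia)
    | succ i ih =>
      intro hi
      rcases ih (by lia) with hreach | hr
      · rcases hreach.regular hA h (by lia) with hG | hz
        · left
          intro l hl
          rcases Nat.lt_succ_iff_lt_or_eq.1 hl with hl | rfl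
          exacts [hreach l hl, hG]
        · exact .inr (CGState.next_of_r_eq_zero hz.1).1
      · exact .inr (CGState.next_of_r_eq_zero hr).1
  intro i hi
  rcases hmain i hi with hreach | hr
  · exact hreach.regular hA h hi
  · exact .inr ⟨hr, p_eq_zero_of_r_eq_zero hr⟩

/-- The three-term recursion: `A p_i` is a combination of `p_0, …, p_{i+1}`. -/
theorem apply_p_mem_span {k i : ℕ} (hreg : CGRegular A (cgState A g i)) (hi : i + 1 < k) :
    T (cgState A g i).p ∈ Submodule.span ℝ (Set.range fun i : Fin k => (cgState A g i).p) := by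
  have hp : ∀ l < k, (cgState A g l).p ∈
      Submodule.span ℝ (Set.range fun i : Fin k => (cgState A g i).p) :=
    fun l hl => Submodule.subset_span ⟨⟨l, hl⟩, rfl⟩
  have hr : ∀ l < k, (cgState A g l).r ∈
      Submodule.span ℝ (Set.range fun i : Fin k => (cgState A g i).p) := by
    intro l hl
    cases l with
    | zero => simpa [cgState, CGState.init] using hp 0 hl
    | succ l =>
      have : (cgState A g (l + 1)).r =
          (cgState A g l).beta A • (cgState A g l).p - (cgState A g (l + 1)).p := by
        rw [cgState_succ, CGState.next_p]; abel
      rw [this]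
      exact sub_mem (Submodule.smul_mem _ _ (hp l (by lia))) (hp _ hl)
  rcases hreg with hG | hG
  · have := CGState.smul_apply_p (A := A) (cgState A g i)
    rw [← cgState_succ] at this
    rw [← Submodule.smul_mem_iff _ (CGState.alpha_pos hG).ne', this]
    exact sub_mem (hr _ hi) (hr _ (by lia))
  · simp [hG.2]

theorem pow_apply_mem_span {k : ℕ} (hreg : ∀ i < k, CGRegular A (cgState A g i)) {m : ℕ}
    (hm : m < k) :
    (T ^ m) g ∈ Submodule.span ℝ (Set.range fun i : Fin (m + 1) => (cgState A g i).p) := by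
  induction m with
  | zero =>
    rw [← Submodule.neg_mem_iff]
    exact Submodule.subset_span ⟨0, by simp [cgState, CGState.init]⟩
  | succ m ih =>
    rw [pow_succ', mul_apply_eq_comp]
    have h1 := ih (by lia)
    have h2 : Submodule.span ℝ (Set.range fun i : Fin (m + 1) => (cgState A g i).p) ≤
        (Submodule.span ℝ (Set.range fun i : Fin (m + 2) => (cgState A g i).p)).comap
          (T : EuclideanSpace ℝ (Fin n) →ₗ[ℝ] EuclideanSpace ℝ (Fin n)) := by
      rw [Submodule.span_le]
      rintro _ ⟨i, rfl⟩
      exact apply_p_mem_span (hreg i (by lia)) (by lia)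
    exact h2 h1

/-- The search directions `p_0, …, p_{k-1}` span the Krylov space of order `k`. -/
theorem aeval_apply_mem_span {k : ℕ} (hreg : ∀ i < k, CGRegular A (cgState A g i))
    {q : Polynomial ℝ} (hq : q.natDegree < k) :
    (Polynomial.aeval T q) g ∈
      Submodule.span ℝ (Set.range fun i : Fin k => (cgState A g i).p) := by
  rw [Polynomial.aeval_eq_sum_range, _root_.sum_apply]
  refine Submodule.sum_mem _ fun m hm => ?_
  rw [_root_.smul_apply]
  refine Submodule.smul_mem _ _ (Submodule.span_mono ?_
    (pow_apply_mem_span hreg (show m < k by simp at hm; lia)))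
  rintro _ ⟨i, rfl⟩
  have : i.1 < k := by have := i.2; simp at hm; lia
  exact ⟨⟨i, this⟩, rfl⟩

theorem quadForm_nonneg_of_mem_span (hA : A.IsHermitian) {k : ℕ}
    (hreg : ∀ i < k, CGRegular A (cgState A g i)) {w : EuclideanSpace ℝ (Fin n)}
    (hw : w ∈ Submodule.span ℝ (Set.range fun i : Fin k => (cgState A g i).p)) :
    0 ≤ quadForm A w := by
  obtain ⟨c, rfl⟩ := (Submodule.mem_span_range_iff_exists_fun ℝ).1 hw
  have hinv : ∀ i : Fin k, CGInvariant A g i := fun i =>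
    cgInvariant_of_regular hA fun l hl => hreg l (by lia)
  have hconj : ∀ i j : Fin k, i ≠ j →
      inner ℝ (cgState A g i).p (T (cgState A g j).p) = 0 := by
    intro i j hij
    rcases lt_or_gt_of_ne hij with h | h
    · rw [← inner_toEuclideanCLM_comm hA, real_inner_comm]
      exact (hinv j).inner_p_apply_p i h
    · exact (hinv i).inner_p_apply_p j h
  rw [quadForm, map_sum, sum_inner]
  refine Finset.sum_nonneg fun i _ => ?_
  rw [inner_sum, Finset.sum_eq_single i (fun j _ hji => ?_) (by simp)]
  · rw [map_smul, real_inner_smul_left, inner_smul_right, ← mul_assoc]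
    refine mul_nonneg (mul_self_nonneg _) ?_
    rcases hreg i i.2 with hG | hG
    · exact hG.1.le
    · simp [hG.2]
  · rw [map_smul, real_inner_smul_left, inner_smul_right, hconj i j hji.symm]; simp

end CG

/-! ### Chebyshev polynomials of odd degree -/

open Polynomial in
/-- The polynomial `w_N` of degree `N` with `x w_N(x²) = T_{2N+1}(x)`, where `T` denotes the
Chebyshev polynomials of the first kind. The recursion is
`T_{m+4}(x) = 2 T_2(x) T_{m+2}(x) - T_m(x)` for `m = 2N + 1`, written in the variable `x²`. -/
noncomputable def oddChebyshevQuotient : ℕ → ℝ[X]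
  | 0 => 1
  | 1 => 4 * X - 3
  | N + 2 => 2 * (2 * X - 1) * oddChebyshevQuotient (N + 1) - oddChebyshevQuotient N

open Polynomial in
theorem natDegree_oddChebyshevQuotient_le (N : ℕ) : (oddChebyshevQuotient N).natDegree ≤ N := by
  induction N using Nat.twoStepInduction with
  | zero => simp [oddChebyshevQuotient]
  | one =>
    rw [oddChebyshevQuotient]
    compute_degree
  | more N ih0 ih1 =>
    rw [oddChebyshevQuotient]
    have h1 : (2 * (2 * X - 1) : ℝ[X]).natDegree ≤ 1 := by compute_degree
    refine (natDegree_sub_le _ _).trans (max_le ?_ (by lia))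
    exact natDegree_mul_le.trans (by lia)

theorem eval_cos_sq_oddChebyshevQuotient (N : ℕ) (θ : ℝ) :
    (oddChebyshevQuotient N).eval (Real.cos θ ^ 2) * Real.cos θ = Real.cos ((2 * N + 1) * θ) := by
  induction N using Nat.twoStepInduction with
  | zero => simp [oddChebyshevQuotient]
  | one =>
    simp only [oddChebyshevQuotient, Polynomial.eval_sub, Polynomial.eval_mul,
      Polynomial.eval_ofNat, Polynomial.eval_X]
    rw [show (2 * ((1 : ℕ) : ℝ) + 1) * θ = 3 * θ by push_cast; ring, Real.cos_three_mul]
    ring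
  | more N ih0 ih1 =>
    simp only [oddChebyshevQuotient, Polynomial.eval_sub, Polynomial.eval_mul,
      Polynomial.eval_ofNat, Polynomial.eval_X, Polynomial.eval_one]
    have h1 := Real.cos_add ((2 * (N + 1 : ℕ) + 1) * θ) (2 * θ)
    have h2 := Real.cos_sub ((2 * (N + 1 : ℕ) + 1) * θ) (2 * θ)
    rw [show (2 * ((N + 1 : ℕ) : ℝ) + 1) * θ + 2 * θ = (2 * ((N + 2 : ℕ) : ℝ) + 1) * θ by
      push_cast; ring] at h1
    rw [show (2 * ((N + 1 : ℕ) : ℝ) + 1) * θ - 2 * θ = (2 * (N : ℝ) + 1) * θ by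
      push_cast; ring] at h2
    rw [Real.cos_two_mul] at h1 h2
    linear_combination 2 * (2 * Real.cos θ ^ 2 - 1) * ih1 - ih0 - h1 - h2

/-- The identity `eval_cos_sq_oddChebyshevQuotient` at the imaginary points `x = i sinh u`. -/
theorem eval_neg_sinh_sq_oddChebyshevQuotient (N : ℕ) (u : ℝ) :
    (oddChebyshevQuotient N).eval (-Real.sinh u ^ 2) * Real.sinh u =
      (-1) ^ N * Real.sinh ((2 * N + 1) * u) := by
  induction N using Nat.twoStepInduction with
  | zero => simp [oddChebyshevQuotient]
  | one =>
    simp only [oddChebyshevQuotient, Polynomial.eval_sub, Polynomial.eval_mul,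
      Polynomial.eval_ofNat, Polynomial.eval_X]
    rw [show (2 * ((1 : ℕ) : ℝ) + 1) * u = 3 * u by push_cast; ring, Real.sinh_three_mul]
    ring
  | more N ih0 ih1 =>
    simp only [oddChebyshevQuotient, Polynomial.eval_sub, Polynomial.eval_mul,
      Polynomial.eval_ofNat, Polynomial.eval_X, Polynomial.eval_one]
    have h1 := Real.sinh_add ((2 * (N + 1 : ℕ) + 1) * u) (2 * u)
    have h2 := Real.sinh_sub ((2 * (N + 1 : ℕ) + 1) * u) (2 * u)
    rw [show (2 * ((N + 1 : ℕ) : ℝ) + 1) * u + 2 * u = (2 * ((N + 2 : ℕ) : ℝ) + 1) * u by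
      push_cast; ring] at h1
    rw [show (2 * ((N + 1 : ℕ) : ℝ) + 1) * u - 2 * u = (2 * (N : ℝ) + 1) * u by
      push_cast; ring] at h2
    rw [Real.cosh_two_mul, Real.cosh_sq] at h1 h2
    rw [pow_succ (-1 : ℝ) N] at ih1
    rw [pow_add (-1 : ℝ) N 2, neg_one_sq]
    linear_combination 2 * (-2 * Real.sinh u ^ 2 - 1) * ih1 - ih0 - (-1) ^ N * h1 - (-1) ^ N * h2

theorem mul_sq_eval_oddChebyshevQuotient_le_one (N : ℕ) {x : ℝ} (h0 : 0 ≤ x) (h1 : x ≤ 1) :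
    x * (oddChebyshevQuotient N).eval x ^ 2 ≤ 1 := by
  have hcos : Real.cos (Real.arccos √x) = √x :=
    Real.cos_arccos (by linarith [Real.sqrt_nonneg x]) (Real.sqrt_le_one.2 h1)
  have h := eval_cos_sq_oddChebyshevQuotient N (Real.arccos √x)
  rw [hcos, Real.sq_sqrt h0] at h
  calc x * (oddChebyshevQuotient N).eval x ^ 2
      = ((oddChebyshevQuotient N).eval x * √x) ^ 2 := by rw [mul_pow, Real.sq_sqrt h0]; ring
    _ ≤ 1 := by rw [h]; exact Real.cos_sq_le_one _

/-- This compares the growth rate `2 arsinh √((ε/2) / (M + ε/2))` of the Chebyshev polynomials with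
the rate `√(ε / M)` in the iteration limit, where `σ = √(ε / M)`. -/
theorem sinh_half_sq_le {σ : ℝ} (h0 : 0 ≤ σ) (h1 : σ ≤ 1) :
    Real.sinh (σ / 2) ^ 2 ≤ σ ^ 2 / (2 + σ ^ 2) := by
  have hcosh : Real.cosh σ = 1 + 2 * Real.sinh (σ / 2) ^ 2 := by
    have := Real.cosh_two_mul (σ / 2)
    rw [Real.cosh_sq, mul_div_cancel₀ σ two_ne_zero] at this
    linarith
  have hexp := Real.cosh_le_exp_half_sq σ
  -- For `t = σ² / 2 ≤ 1 / 2` it remains to compare `cosh σ ≤ exp t` with `(1 + 3 t) / (1 + t)`;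
  -- the two are close at `t = 1 / 2`, so the Taylor estimate needs order three.
  obtain ⟨t, ht⟩ : ∃ t, t = σ ^ 2 / 2 := ⟨_, rfl⟩
  have ht0 : 0 ≤ t := ht ▸ by positivity
  have ht1 : t ≤ 1 / 2 := by rw [ht]; nlinarith
  have hb := Real.exp_bound' ht0 (by linarith) (n := 3) (by norm_num)
  norm_num [Finset.sum_range_succ, Nat.factorial] at hb
  rw [← ht] at hexp
  rw [le_div_iff₀ (by positivity), show σ ^ 2 = 2 * t by linarith]
  have h3 : Real.exp t * (1 + t) ≤ 1 + 3 * t := by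
    refine (mul_le_mul_of_nonneg_right hb (by linarith)).trans ?_
    have h4 : t * t ≤ t * (1 / 2) := mul_le_mul_of_nonneg_left ht1 ht0
    have h5 : t ^ 3 ≤ t * (1 / 4) := by nlinarith
    have h6 : t ^ 4 ≤ t * (1 / 8) := by nlinarith
    nlinarith
  nlinarith

theorem le_sinh_sq_of_log_le {W y : ℝ} (hW : 0 < W) (h : Real.log W ≤ 2 * y) :
    (W - 2) / 4 ≤ Real.sinh y ^ 2 := by
  have h1 := (Real.log_le_iff_le_exp hW).1 h
  have h2 := Real.cosh_two_mul y
  rw [Real.cosh_sq, Real.cosh_eq] at h2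
  linarith [Real.exp_pos (-(2 * y))]

/-- A polynomial `q` of degree at most `N` for which `x q(x)²` is bounded by `L = M + ε / 2` on
`[0, L]` and exponentially large in `N` at the negative number `l`. -/
theorem exists_polynomial_small_on_Icc {M ε l W : ℝ} (hε : 0 < ε) (hεM : ε ≤ M)
    (hl : l ≤ -(ε / 2)) (hW : 1 ≤ W) {N : ℕ} (hN : 1 / 2 * Real.log W * √(M / ε) ≤ N) :
    ∃ q : Polynomial ℝ, q.natDegree ≤ N ∧
      (∀ x, 0 ≤ x → x ≤ M + ε / 2 → x * q.eval x ^ 2 ≤ M + ε / 2) ∧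
      (M + ε / 2) * ((W - 2) / 4) ≤ -l * q.eval l ^ 2 := by
  have hM : 0 < M := hε.trans_le hεM
  obtain ⟨L, hL⟩ : ∃ L, L = M + ε / 2 := ⟨_, rfl⟩
  have hL0 : 0 < L := by rw [hL]; linarith
  rw [← hL]
  refine ⟨(oddChebyshevQuotient N).comp (Polynomial.C L⁻¹ * Polynomial.X), ?_,
    fun x hx hxL => ?_, ?_⟩
  · refine Polynomial.natDegree_comp_le.trans ?_
    calc _ ≤ N * 1 := Nat.mul_le_mul (natDegree_oddChebyshevQuotient_le N)
          ((Polynomial.natDegree_C_mul_le _ _).trans Polynomial.natDegree_X_le)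
      _ = N := mul_one N
  · have h := mul_sq_eval_oddChebyshevQuotient_le_one N (x := L⁻¹ * x) (by positivity)
      (by rw [inv_mul_le_iff₀ hL0]; linarith)
    simp only [Polynomial.eval_comp, Polynomial.eval_mul, Polynomial.eval_C, Polynomial.eval_X]
    calc _ = L * (L⁻¹ * x * (oddChebyshevQuotient N).eval (L⁻¹ * x) ^ 2) := by field_simp
      _ ≤ L := mul_le_of_le_one_right hL0.le h
  · have hl0 : 0 < -l := by linarith
    obtain ⟨u, hu⟩ : ∃ u, Real.sinh u = √(-l / L) := ⟨Real.arsinh _, Real.sinh_arsinh _⟩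
    have hu2 : Real.sinh u ^ 2 = -l / L := by rw [hu, Real.sq_sqrt (by positivity)]
    -- `u` grows with `-l`, and the worst case is `-l = ε / 2`.
    have hσ : √(ε / M) ≤ 2 * u := by
      have hσ1 : √(ε / M) ≤ 1 := Real.sqrt_le_one.2 ((div_le_one hM).2 hεM)
      have h1 := sinh_half_sq_le (Real.sqrt_nonneg _) hσ1
      rw [Real.sq_sqrt (by positivity)] at h1
      have h2 : ε / M / (2 + ε / M) ≤ -l / L := by
        rw [show ε / M / (2 + ε / M) = (ε / 2) / L by rw [hL]; field_simp]
        gcongr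
        linarith
      have h3 : Real.sinh (√(ε / M) / 2) ≤ Real.sinh u := by
        refine le_of_sq_le_sq (by rw [hu2]; exact h1.trans h2) (by rw [hu]; positivity)
      linarith [Real.sinh_le_sinh.1 h3]
    have hlog : Real.log W ≤ 2 * ((2 * N + 1) * u) := by
      have hMε : √(M / ε) * √(ε / M) = 1 := by
        rw [← Real.sqrt_mul (by positivity)]
        field_simp
        simp
      have h0 : 0 ≤ √(ε / M) := Real.sqrt_nonneg _
      have h1 := mul_le_mul_of_nonneg_right hN h0
      have h2 : (N : ℝ) * √(ε / M) ≤ N * (2 * u) :=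
        mul_le_mul_of_nonneg_left hσ (Nat.cast_nonneg N)
      have h3 : 1 / 2 * Real.log W * √(M / ε) * √(ε / M) = 1 / 2 * Real.log W := by
        rw [mul_assoc, hMε, mul_one]
      linarith
    have h := eval_neg_sinh_sq_oddChebyshevQuotient N u
    simp only [Polynomial.eval_comp, Polynomial.eval_mul, Polynomial.eval_C, Polynomial.eval_X]
    rw [show L⁻¹ * l = -Real.sinh u ^ 2 by rw [hu2]; field_simp]
    calc L * ((W - 2) / 4) ≤ L * Real.sinh ((2 * N + 1) * u) ^ 2 := by
          gcongr
          exact le_sinh_sq_of_log_le (by linarith) hlog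
      _ = L * ((-1) ^ N * Real.sinh ((2 * N + 1) * u)) ^ 2 := by
          rw [mul_pow, ← pow_mul, mul_comm N 2, pow_mul]; simp
      _ = -l * (oddChebyshevQuotient N).eval (-Real.sinh u ^ 2) ^ 2 := by
          rw [← h, mul_pow, hu2]; field_simp

/-! ### Spectral form of the failure event and choice of the polynomial -/

theorem ContinuousLinearMap.aeval_apply_of_apply_eq_smul {E : Type*} [NormedAddCommGroup E]
    [NormedSpace ℝ E] {a : E →L[ℝ] E} {v : E} {c : ℝ} (h : a v = c • v) (q : Polynomial ℝ) :
    Polynomial.aeval a q v = q.eval c • v := by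
  induction q using Polynomial.induction_on with
  | C r => simp [Algebra.algebraMap_eq_smul_one]
  | add p q hp hq => simp [hp, hq, add_smul]
  | monomial k r ih =>
    rw [pow_succ, ← mul_assoc, map_mul, mul_apply_eq_comp, Polynomial.aeval_X, h, map_smul, ih,
      smul_smul, Polynomial.eval_mul (q := Polynomial.X), Polynomial.eval_X, mul_comm]

section
variable {n : ℕ} {H : Matrix (Fin n) (Fin n) ℝ} (hH : H.IsHermitian)

theorem toEuclideanCLM_eigenvectorBasis (i : Fin n) :
    Matrix.toEuclideanCLM (n := Fin n) (𝕜 := ℝ) H (hH.eigenvectorBasis i) =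
      hH.eigenvalues i • hH.eigenvectorBasis i := by
  ext j
  simpa using congrFun (hH.mulVec_eigenvectorBasis i) j

theorem toEuclideanCLM_add_smul_one_apply (c : ℝ) (x : EuclideanSpace ℝ (Fin n)) :
    Matrix.toEuclideanCLM (n := Fin n) (𝕜 := ℝ) (H + c • (1 : Matrix (Fin n) (Fin n) ℝ)) x =
      Matrix.toEuclideanCLM (n := Fin n) (𝕜 := ℝ) H x + c • x := by
  simp

theorem quadForm_add_smul_one (c : ℝ) (x : EuclideanSpace ℝ (Fin n)) :
    quadForm (H + c • (1 : Matrix (Fin n) (Fin n) ℝ)) x = quadForm H x + c * ‖x‖ ^ 2 := by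
  rw [quadForm, toEuclideanCLM_add_smul_one_apply, inner_add_right, inner_smul_right,
    real_inner_self_eq_norm_sq, quadForm]

theorem abs_eigenvalues_le (i : Fin n) :
    |hH.eigenvalues i| ≤ ‖Matrix.toEuclideanCLM (n := Fin n) (𝕜 := ℝ) H‖ := by
  have h := (Matrix.toEuclideanCLM (n := Fin n) (𝕜 := ℝ) H).le_opNorm (hH.eigenvectorBasis i)
  rw [toEuclideanCLM_eigenvectorBasis, norm_smul, hH.eigenvectorBasis.norm_eq_one] at h
  simpa using h

theorem quadForm_aeval_apply {A : Matrix (Fin n) (Fin n) ℝ}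
    (v : OrthonormalBasis (Fin n) ℝ (EuclideanSpace ℝ (Fin n))) {μ : Fin n → ℝ}
    (hv : ∀ i, Matrix.toEuclideanCLM (n := Fin n) (𝕜 := ℝ) A (v i) = μ i • v i)
    (q : Polynomial ℝ) (x : EuclideanSpace ℝ (Fin n)) :
    quadForm A (Polynomial.aeval (Matrix.toEuclideanCLM (n := Fin n) (𝕜 := ℝ) A) q x) =
      ∑ i, μ i * (q.eval (μ i)) ^ 2 * inner ℝ (v i) x ^ 2 := by
  have hx : Polynomial.aeval (Matrix.toEuclideanCLM (n := Fin n) (𝕜 := ℝ) A) q x =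
      ∑ i, (inner ℝ (v i) x * q.eval (μ i)) • v i := by
    conv_lhs => rw [← v.sum_repr' x]
    simp_rw [map_sum, map_smul, ContinuousLinearMap.aeval_apply_of_apply_eq_smul (hv _), smul_smul]
  rw [hx, quadForm, map_sum]
  simp_rw [map_smul, hv, smul_smul]
  rw [v.orthonormal.inner_sum]
  refine Finset.sum_congr rfl fun i _ => ?_
  simp
  ring

end

/-- The vectors `g` from which conjugate gradients find no nonpositive curvature in `k` iterations
lie in a double cone around the hyperplane orthogonal to the eigenvector `v i`. -/
theorem mul_inner_sq_le_of_not_finds {m : ℕ} {A : Matrix (Fin (m + 1)) (Fin (m + 1)) ℝ}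
    (hA : A.IsHermitian) (v : OrthonormalBasis (Fin (m + 1)) ℝ (EuclideanSpace ℝ (Fin (m + 1))))
    {μ : Fin (m + 1) → ℝ}
    (hv : ∀ i, Matrix.toEuclideanCLM (n := Fin (m + 1)) (𝕜 := ℝ) A (v i) = μ i • v i)
    {q : Polynomial ℝ} {k : ℕ} (hq : q.natDegree < k) (i : Fin (m + 1)) {c d : ℝ}
    (hc : ∀ j, μ j * q.eval (μ j) ^ 2 ≤ c) (hd : d ≤ -μ i * q.eval (μ i) ^ 2)
    {g : EuclideanSpace ℝ (Fin (m + 1))} (hg : ¬ CGFindsNonposCurvature A g k) :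
    d * inner ℝ (v i) g ^ 2 ≤ c * ∑ j, inner ℝ (v (i.succAbove j)) g ^ 2 := by
  have hreg := cgRegular_of_not_finds hA hg
  have h := quadForm_nonneg_of_mem_span hA hreg (aeval_apply_mem_span hreg hq)
  rw [quadForm_aeval_apply v hv, Fin.sum_univ_succAbove _ i] at h
  have h1 : ∑ j, μ (i.succAbove j) * q.eval (μ (i.succAbove j)) ^ 2 *
      inner ℝ (v (i.succAbove j)) g ^ 2 ≤ c * ∑ j, inner ℝ (v (i.succAbove j)) g ^ 2 := by
    rw [Finset.mul_sum]
    exact Finset.sum_le_sum fun j _ => mul_le_mul_of_nonneg_right (hc _) (sq_nonneg _)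
  have h2 := mul_le_mul_of_nonneg_right hd (sq_nonneg (inner ℝ (v i) g))
  linarith

/-- A polynomial of degree less than the iteration limit for which the double cone of
`mul_inner_sq_le_of_not_finds` has probability at most `δ`. -/
theorem exists_polynomial_iterLimit {n : ℕ} (hn : 1 ≤ n) (μ : Fin n → ℝ) (i : Fin n)
    {M ε δ : ℝ} (hε : 0 < ε) (hεM : ε ≤ M) (hδ₀ : 0 ≤ δ) (hδ₁ : δ < 1)
    (hμ : ∀ j, μ j ≤ M + ε / 2) (hi : μ i ≤ -(ε / 2)) :
    ∃ q : Polynomial ℝ, ∃ c d : ℝ, q.natDegree < iterLimit n M ε δ ∧ 0 ≤ c ∧ 0 < d ∧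
      (∀ j, μ j * q.eval (μ j) ^ 2 ≤ c) ∧ d ≤ -μ i * q.eval (μ i) ^ 2 ∧
      2 / Real.pi * (n - 1 : ℝ) * (c / d) ≤ δ ^ 2 := by
  have hμi : 0 < -μ i := by linarith
  -- This case includes `δ = 0`.
  by_cases hk : iterLimit n M ε δ = n
  · classical
    rw [hk]
    set s := (Finset.univ.image μ).erase (μ i)
    have hs : s.card < n := by
      have h1 : μ i ∈ Finset.univ.image μ := Finset.mem_image_of_mem _ (Finset.mem_univ i)
      calc s.card < (Finset.univ.image μ).card := Finset.card_erase_lt_of_mem h1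
        _ ≤ n := Finset.card_image_le.trans (by simp)
    refine ⟨∏ x ∈ s, (Polynomial.X - Polynomial.C x), 0, _, by simpa using hs, le_rfl,
      mul_pos hμi (sq_pos_of_ne_zero ?_), fun j => ?_, le_rfl, by simpa using sq_nonneg δ⟩
    · rw [Polynomial.eval_prod, Finset.prod_ne_zero_iff]
      intro x hx
      simpa [sub_eq_zero] using (Finset.ne_of_mem_erase hx).symm
    · by_cases hj : μ j = μ i
      · rw [hj]
        exact mul_nonpos_of_nonpos_of_nonneg (by linarith) (sq_nonneg _)
      · have hjs : μ j ∈ s :=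
          Finset.mem_erase.2 ⟨hj, Finset.mem_image_of_mem _ (Finset.mem_univ j)⟩
        rw [Polynomial.eval_prod, Finset.prod_eq_zero hjs (by simp)]
        simp
  · have hδ : δ ≠ 0 := fun h => hk (by simp [iterLimit, h])
    have hδp : 0 < δ := lt_of_le_of_ne hδ₀ hδ.symm
    set W : ℝ := 2.75 * n / δ ^ 2 with hW
    have hlim : iterLimit n M ε δ = 1 + ⌈1 / 2 * Real.log W * √(M / ε)⌉₊ := by
      rw [iterLimit, if_neg hδ] at hk ⊢
      exact (min_choice _ _).resolve_left hk
    have hn' : (1 : ℝ) ≤ n := by exact_mod_cast hn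
    have hδW : δ ^ 2 * W = 2.75 * n := by rw [hW]; field_simp
    have hδ2 : δ ^ 2 ≤ 1 := pow_le_one₀ hδ₀ hδ₁.le
    -- As `2.75 > 8 / 3 > 8 / π`, the final estimate needs no more than `π > 3`.
    have hW2 : 2 < W := by
      rw [hW, lt_div_iff₀ (by positivity)]
      linarith
    obtain ⟨q, hq, hsmall, hlarge⟩ := exists_polynomial_small_on_Icc hε hεM hi
      (by linarith : 1 ≤ W) (Nat.le_ceil _)
    have hL : 0 < M + ε / 2 := by linarith
    refine ⟨q, M + ε / 2, (M + ε / 2) * ((W - 2) / 4), by lia, hL.le,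
      mul_pos hL (by linarith), fun j => ?_, hlarge, ?_⟩
    · rcases le_total 0 (μ j) with h | h
      · exact hsmall _ h (hμ j)
      · exact (mul_nonpos_of_nonpos_of_nonneg h (sq_nonneg _)).trans hL.le
    · have h4 : (M + ε / 2) / ((M + ε / 2) * ((W - 2) / 4)) = 4 / (W - 2) := by
        rw [div_mul_cancel_left₀ hL.ne', inv_div]
      have hπ : 2 / Real.pi ≤ 2 / 3 := by
        gcongr
        exact Real.pi_gt_three.le
      rw [h4, ← mul_div_assoc, div_le_iff₀ (by linarith)]
      have h5 := mul_le_mul_of_nonneg_right hπ (by linarith : (0 : ℝ) ≤ n - 1)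
      linarith

theorem uniformSphere_not_finds_le {n : ℕ} (hn : 1 ≤ n) {H : Matrix (Fin n) (Fin n) ℝ}
    (hH : H.IsHermitian) {M ε δ : ℝ} (hM : ‖Matrix.toEuclideanCLM (n := Fin n) (𝕜 := ℝ) H‖ ≤ M)
    (hε : 0 < ε) (hδ₀ : 0 ≤ δ) (hδ₁ : δ < 1) (hlt : lambdaMin hH < -ε) :
    (uniformSphere n).real {b | ¬ CGFindsNonposCurvature
      (H + (ε / 2) • (1 : Matrix (Fin n) (Fin n) ℝ)) (-b.1) (iterLimit n M ε δ)} ≤ δ := by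
  obtain ⟨m, rfl⟩ : ∃ m, n = m + 1 := ⟨n - 1, by lia⟩
  have := isProbabilityMeasure_uniformSphere hn
  obtain ⟨i, hi⟩ : ∃ i, hH.eigenvalues i = lambdaMin hH := exists_eq_ciInf_of_finite
  have hbd : ∀ j, |hH.eigenvalues j| ≤ M := fun j => (abs_eigenvalues_le hH j).trans hM
  obtain ⟨q, c, d, hq, hc0, hd0, hc, hd, hle⟩ := exists_polynomial_iterLimit hn
    (fun j => hH.eigenvalues j + ε / 2) i hε (M := M) (by linarith [(abs_le.1 (hbd i)).1]) hδ₀ hδ₁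
    (fun j => by linarith [(abs_le.1 (hbd j)).2]) (by simp only [hi]; linarith)
  have hA : (H + (ε / 2) • (1 : Matrix (Fin (m + 1)) (Fin (m + 1)) ℝ)).IsHermitian :=
    hH.add (Matrix.isHermitian_one.smul (IsSelfAdjoint.all _))
  calc _ ≤ (uniformSphere (m + 1)).real {b | inner ℝ (hH.eigenvectorBasis i) b.1 ^ 2 ≤
        c / d * ∑ j, inner ℝ (hH.eigenvectorBasis (i.succAbove j)) b.1 ^ 2} := by
        refine measureReal_mono fun b hb => ?_
        have h := mul_inner_sq_le_of_not_finds hA hH.eigenvectorBasis (fun j => by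
          rw [toEuclideanCLM_add_smul_one_apply, toEuclideanCLM_eigenvectorBasis, add_smul])
          hq i hc hd hb
        simp only [inner_neg_right, neg_sq] at h
        rw [Set.mem_ofPred_eq, div_mul_eq_mul_div, le_div_iff₀ hd0]
        linarith
    _ ≤ √(2 / Real.pi * m * (c / d)) := uniformSphere_double_cone_le _ i (by positivity)
    _ ≤ √(δ ^ 2) := Real.sqrt_le_sqrt (by simpa using hle)
    _ = δ := Real.sqrt_sq hδ₀

theorem theorem1 (n : ℕ) (hn : 1 ≤ n) (H : Matrix (Fin n) (Fin n) ℝ) (hH : H.IsHermitian)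
    (M ε δ : ℝ) (hM : ‖Matrix.toEuclideanCLM (n := Fin n) (𝕜 := ℝ) H‖ ≤ M)
    (hε : 0 < ε) (hδ₀ : 0 ≤ δ) (hδ₁ : δ < 1) :
    (lambdaMin hH < -ε →
      1 - δ ≤ (uniformSphere n).real {b | ∃ j < iterLimit n M ε δ,
        CGTerminatesAt (H + (ε / 2) • (1 : Matrix (Fin n) (Fin n) ℝ)) (-b.1) j ∧
        (cgState (H + (ε / 2) • (1 : Matrix (Fin n) (Fin n) ℝ)) (-b.1) j).p ≠ 0 ∧
        quadForm H (cgState (H + (ε / 2) • (1 : Matrix (Fin n) (Fin n) ℝ)) (-b.1) j).p ≤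
          -(ε / 2) * ‖(cgState (H + (ε / 2) • (1 : Matrix (Fin n) (Fin n) ℝ)) (-b.1) j).p‖ ^ 2}) ∧
    1 - δ ≤ (uniformSphere n).real {b |
      ¬ CGFindsNonposCurvature (H + (ε / 2) • (1 : Matrix (Fin n) (Fin n) ℝ)) (-b.1)
          (iterLimit n M ε δ) →
        -ε ≤ lambdaMin hH} := by
  have := isProbabilityMeasure_uniformSphere hn
  have hfind : lambdaMin hH < -ε → 1 - δ ≤ (uniformSphere n).real {b | CGFindsNonposCurvature
      (H + (ε / 2) • (1 : Matrix (Fin n) (Fin n) ℝ)) (-b.1) (iterLimit n M ε δ)} := by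
    intro hlt
    have h1 := uniformSphere_not_finds_le hn hH hM hε hδ₀ hδ₁ hlt
    set S := {b : Metric.sphere (0 : EuclideanSpace ℝ (Fin n)) 1 | CGFindsNonposCurvature
      (H + (ε / 2) • (1 : Matrix (Fin n) (Fin n) ℝ)) (-b.1) (iterLimit n M ε δ)}
    -- subadditivity suffices here, so the measurability of `S` is not needed
    have h2 := measureReal_union_le (μ := uniformSphere n) S Sᶜ
    rw [Set.union_compl_self, probReal_univ] at h2
    change (uniformSphere n).real Sᶜ ≤ δ at h1
    linarith
  refine ⟨fun hlt => (hfind hlt).trans (measureReal_mono ?_), ?_⟩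
  · rintro b ⟨j, hj, hreach, hp, hquad⟩
    refine ⟨j, hj, ⟨hreach, fun hG => not_lt.2 hquad hG.1⟩, hp, ?_⟩
    rw [quadForm_add_smul_one] at hquad
    linarith
  · rcases lt_or_ge (lambdaMin hH) (-ε) with hlt | hge
    · exact (hfind hlt).trans (measureReal_mono fun b hb hnot => absurd hb hnot)
    · simpa [hge] using hδ₀
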